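/- Consider two transmitter-receiver pairs communicating over the binary interference channel $$Y_i[t]=S_{ii}[t]X_i[t]\oplus S_{\bar i i}[t]X_{\bar i}[t],\qquad i=1,2,\ \bar i=3-i,$$ where the link gains $S_{ij}[t]\in\{0,1\}$ are independent over links and time, $\Pr(S_{ij}[t]=1)=1-\delta_{ij}$ with $\delta_{ij}\in[0,1]$. In each slot a Poisson$(\lambda_i)$ number of uniform data bits arrives at transmitter $i$, $0\le\lambda_i\le 1$; arrivals and bit values are independent over users and time, of each other, and of the channel. The signal $X_i[t]$ is a function of the bits that have arrived at transmitter $i$ by time $t$, of the numbers of bits that have arrived at both transmitters by time $t$ (these numbers are announced to all nodes), and of the past link gains $S[1],\dots,S[t-1]$ (delayed channel state information). Let $K_i^n$ be the number of bits that arrive at transmitter $i$ during the first $n$ slots and are decodable at receiver $i$, i.e. are determined by $Y_i[1],\dots,Y_i[n]$, all link gains up to time $n$ and the numbers of arrivals; let $\hat\lambda_i^n=\mathbb E[K_i^n/n]$ be the delivered rate. For $\epsilon\in(0,1)$ let $\mathcal D_\epsilon$ be the closure of the set of arrival rate pairs $(\lambda_1,\lambda_2)\in[0,1]^2$ for which there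 are schemes, one for each block length $n$, such that $\lambda_i(1-\epsilon)<\hat\lambda_i^n$ for $i=1,2$ simultaneously, for all sufficiently large $n$. Let the stable throughput region $\mathcal D$ be the closure of the set of pairs in $[0,1]^2$ for which this holds with some $\epsilon=\epsilon_n>0$ that tends to $0$ as $n\to\infty$. Let $\bar{\mathcal C}$ be the set of all $(x_1,x_2)$ such that, for $i=1,2$, $$0\le x_i\le 1-\delta_{ii},\qquad x_i+\frac{1-\delta_{ii}\delta_{i\bar i}}{1-\delta_{i\bar i}}\,x_{\bar i}\le\frac{(1-\delta_{ii}\delta_{i\bar i})(1-\delta_{\bar i\bar i}\delta_{i\bar i})}{1-\delta_{i\bar i}},$$ where the second inequality is void if $\delta_{i\bar i}=1$. Then $\mathcal D\subseteq\bar{\mathcal C}$. Moreover, for every fixed tolerance $\epsilon\in(0,1)$, $(1-\epsilon)\,\mathcal D_\epsilon\subseteq\bar{\mathcal C}$. -/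

import Mathlib

open MeasureTheory ProbabilityTheory Filter Topology

namespace IntermittentIC

/-- The user other than `i` (the two users are `0` and `1`). -/
abbrev other (i : Fin 2) : Fin 2 := 1 - i

/-- State of the four links in one time slot; `s i j` is the gain `S_ij` of the link from
transmitter `i` to receiver `j`. -/
abbrev ChannelState := Fin 2 → Fin 2 → Bool

/-- Erasure probabilities: `δ i j` belongs to the link from transmitter `i` to receiver `j`. -/
abbrev Erasures := Fin 2 → Fin 2 → unitInterval

/-- Everything random in `n` time slots: the link states, the number `a i t` of bits that arrive at
transmitter `i` in slot `t`, and the values of the bits (`b i k` is the value of the `k`-th bit that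
ever arrives at transmitter `i`). -/
abbrev Outcome (n : ℕ) :=
  (Fin n → ChannelState) × (Fin 2 → Fin n → ℕ) × (Fin 2 → ℕ → Bool)

/-- The link gains are independent over links and slots, and `S_ij` is Bernoulli `(1 - δ_ij)`. -/
noncomputable def channelLaw (δ : Erasures) (n : ℕ) : Measure (Fin n → ChannelState) :=
  Measure.pi fun _ => Measure.pi fun i => Measure.pi fun j =>
    bernoulliMeasure true false (unitInterval.symm (δ i j))

/-- The numbers of arrivals are independent over users and slots, Poisson `(l i)` at user `i`. -/
noncomputable def arrivalLaw (l : Fin 2 → ℝ) (n : ℕ) : Measure (Fin 2 → Fin n → ℕ) :=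
  Measure.pi fun i => Measure.pi fun _ => poissonMeasure (l i).toNNReal

/-- The data bits are independent and uniform. -/
noncomputable def bitLaw : Measure (Fin 2 → ℕ → Bool) :=
  Measure.pi fun _ => Measure.infinitePi fun _ => (PMF.uniformOfFintype Bool).toMeasure

/-- Links, arrivals and data bits are mutually independent. -/
noncomputable def law (δ : Erasures) (l : Fin 2 → ℝ) (n : ℕ) : Measure (Outcome n) :=
  (channelLaw δ n).prod ((arrivalLaw l n).prod bitLaw)

/-- A transmission scheme for `n` slots. In slot `t` the signal of transmitter `i` is a function of
the numbers of arrivals up to and including slot `t` (announced to all nodes), of the bits that have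
arrived at transmitter `i` so far, and of the link states of the slots before `t` (delayed CSIT). -/
abbrev Scheme (n : ℕ) :=
  (i : Fin 2) → (t : Fin n) → (a : Fin 2 → Fin (t + 1) → ℕ) → (Fin (∑ r, a i r) → Bool) →
    (Fin t → ChannelState) → Bool

section

variable {n : ℕ} (c : Scheme n) (s : Fin n → ChannelState) (a : Fin 2 → Fin n → ℕ)
  (b : Fin 2 → ℕ → Bool)

/-- The transmitted signal `X_i[t]`. -/
def sent (i : Fin 2) (t : Fin n) : Bool :=
  c i t (fun j r => a j (r.castLE t.isLt)) (fun k => b i k) (fun r => s (r.castLE t.isLt.le))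

/-- The received signal `Y_i[t]`. -/
def received (i : Fin 2) (t : Fin n) : Bool :=
  xor (s t i i && sent c s a b i t) (s t (other i) i && sent c s a b (other i) t)

/-- The `k`-th bit of transmitter `i` is decodable at receiver `i` at the end of the `n` slots: its
value is determined by the received signals, the link states and the numbers of arrivals. -/
def Decodable (i : Fin 2) (k : ℕ) : Prop :=
  ∀ b' : Fin 2 → ℕ → Bool,
    (∀ t, received c s a b' i t = received c s a b i t) → b' i k = b i k

open Classical in
/-- `K_i^n`: the number of bits that arrived at transmitter `i` during the `n` slots and are
decodable at receiver `i`. -/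
noncomputable def numDecodable (i : Fin 2) : ℕ :=
  ((Finset.range (∑ t, a i t)).filter fun k => Decodable c s a b i k).card

end

/-- The delivered rate `E[K_i^n / n]` at receiver `i`, for arrival rates `l`. -/
noncomputable def deliveredRate (δ : Erasures) (l : Fin 2 → ℝ) {n : ℕ} (c : Scheme n)
    (i : Fin 2) : ℝ :=
  ∫ ω, (numDecodable c ω.1 ω.2.1 ω.2.2 i : ℝ) / n ∂law δ l n

/-- The arrival rates `l` lie in `[0, 1]²` and there are schemes, one for each block length `n`,
such that `l i * (1 - ε n) < deliveredRate` for both users simultaneously, as `n → ∞`. -/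
def IsStable (δ : Erasures) (ε : ℕ → ℝ) (l : Fin 2 → ℝ) : Prop :=
  (∀ i, 0 ≤ l i ∧ l i ≤ 1) ∧
    ∃ c : (n : ℕ) → Scheme n, ∀ᶠ n in atTop, ∀ i, l i * (1 - ε n) < deliveredRate δ l (c n) i

/-- The `ε`-stable throughput region, for a fixed tolerance `ε`. -/
def epsStableRegion (δ : Erasures) (ε : ℝ) : Set (Fin 2 → ℝ) :=
  closure {l | IsStable δ (fun _ => ε) l}

/-- The stable throughput region: the tolerance `ε` goes to zero as `n → ∞`. -/
def stableRegion (δ : Erasures) : Set (Fin 2 → ℝ) :=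
  closure {l | ∃ ε : ℕ → ℝ, (∀ n, 0 < ε n) ∧ Tendsto ε atTop (𝓝 0) ∧ IsStable δ ε l}

/-- The outer-bound region. If `δ i (other i) = 1`, the coefficient of the second inequality is
infinite, and the inequality imposes nothing beyond the individual bounds (multiply by
`1 - δ i (other i)`). -/
def outerBound (δ : Erasures) : Set (Fin 2 → ℝ) :=
  {x | ∀ i, (0 ≤ x i ∧ x i ≤ 1 - (δ i i : ℝ)) ∧
    ((δ i (other i) : ℝ) < 1 →
      x i + (1 - (δ i i : ℝ) * δ i (other i)) / (1 - (δ i (other i) : ℝ)) * x (other i) ≤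
        (1 - (δ i i : ℝ) * δ i (other i)) * (1 - (δ (other i) (other i) : ℝ) * δ i (other i)) /
          (1 - (δ i (other i) : ℝ)))}

end IntermittentIC

/-! Every delivered rate pair lies in `outerBound δ`, for every block length and every scheme. Fix
the arrival pattern: the messages become independent uniform strings, independent of the channel. If
receiver `i` decodes `K` bits, its observation leaves `2 ^ (A - K)` candidates among the `2 ^ A`
messages. This exact count replaces Fano's inequality and bounds the mean of `K log 2` by the
entropy of the output minus that of the interference.

Write `H(S)` for the mean entropy of user `i`'s signal seen through a link `S`. Receiver `other i`
loses `H(S_iī)` to interference, and receiver `i` gains at most `H(S_ii) ≤ H(S_ii ∨ S_iī)`. Since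
the state information is delayed, each slot adds the probability that the link is on times the
conditional entropy of the fresh signal. A stronger link conditions on more, so entropy per unit of
link probability decreases with link strength (`meanEntropy_le_of_delayed`). Hence the two entropies
cancel in a weighted sum of the two bounds (`avgDecoded_add_le`).

The bounds are uniform in the arrivals, so they survive averaging over them. The region is closed,
and downward closed among nonnegative pairs; as delivered rates dominate `(1 - ε) • l`, both claims
follow. -/

namespace IntermittentIC

/-! ### Entropy of functions on a finite uniform space -/

section Entropy

open Finset

open scoped Classical in
/-- The fibre of `f` through the point `ω`. -/
noncomputable def fiber {Ω α : Type*} [Fintype Ω] (f : Ω → α) (ω : Ω) : Finset Ω :=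
  univ.filter fun ω' => f ω' = f ω

/-- The Shannon entropy (in nats) of `f ω` for a uniformly distributed `ω`. -/
noncomputable def entropy {Ω α : Type*} [Fintype Ω] (f : Ω → α) : ℝ :=
  (∑ ω, (Real.log (Fintype.card Ω) - Real.log (fiber f ω).card)) / Fintype.card Ω

variable {Ω α β γ : Type*} [Fintype Ω]

@[simp] lemma mem_fiber {f : Ω → α} {ω ω' : Ω} : ω' ∈ fiber f ω ↔ f ω' = f ω := by
  simp [fiber]

lemma fiber_card_pos (f : Ω → α) (ω : Ω) : (0 : ℝ) < (fiber f ω).card := by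
  exact_mod_cast card_pos.mpr ⟨ω, by simp⟩

lemma fiber_congr {f : Ω → α} {ω ω' : Ω} (h : f ω = f ω') : fiber f ω = fiber f ω' := by
  ext x; simp [h]

/-- The sum is 1 on a fibre and 0 on the empty set; double sums below are reduced to these two
cases. -/
lemma sum_inv_fiber_card_le_one (f : Ω → α) (B : Finset Ω)
    (hB : ∀ ω ∈ B, fiber f ω = B) : ∑ ω ∈ B, ((fiber f ω).card : ℝ)⁻¹ ≤ 1 := by
  rw [sum_congr rfl fun ω hω => by rw [hB ω hω]]
  rw [sum_const, nsmul_eq_mul]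
  exact mul_inv_le_one

/-- Gibbs' inequality, in the form used for all entropy estimates below. -/
lemma sum_log_nonpos (r : Ω → ℝ) (hr : ∀ ω, 0 < r ω) (h : ∑ ω, r ω ≤ Fintype.card Ω) :
    ∑ ω, Real.log (r ω) ≤ 0 := by
  have h1 : ∑ ω, Real.log (r ω) ≤ ∑ ω, (r ω - 1) :=
    sum_le_sum fun ω _ => Real.log_le_sub_one_of_pos (hr ω)
  rw [sum_sub_distrib] at h1
  simp at h1
  linarith

lemma entropy_mono {f : Ω → α} {f' : Ω → β} (h : ∀ ω ω', f' ω = f' ω' → f ω = f ω') :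
    entropy f ≤ entropy f' := by
  unfold entropy
  gcongr with ω
  · exact fiber_card_pos f' ω
  · intro x; simpa using h x ω

lemma entropy_congr {f : Ω → α} {f' : Ω → β} (h : ∀ ω ω', f ω = f ω' ↔ f' ω = f' ω') :
    entropy f = entropy f' :=
  le_antisymm (entropy_mono fun ω ω' => (h ω ω').2) (entropy_mono fun ω ω' => (h ω ω').1)

/-- Conditioning on more reduces entropy. -/
lemma entropy_pair_sub_le {f : Ω → α} {f' : Ω → β} (g : Ω → γ)
    (h : ∀ ω ω', f' ω = f' ω' → f ω = f ω') :
    entropy (fun ω => (f' ω, g ω)) - entropy f' ≤ entropy (fun ω => (f ω, g ω)) - entropy f := by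
  classical
  set F : Ω → α × γ := fun ω => (f ω, g ω)
  set F' : Ω → β × γ := fun ω => (f' ω, g ω)
  -- The argument of the logarithm is the ratio of the conditional probabilities of `g ω` given `f
  -- ω` and given `f' ω`.
  have key : ∑ ω, Real.log ((fiber F ω).card * (fiber f' ω).card /
      ((fiber f ω).card * (fiber F' ω).card)) ≤ 0 := by
    refine sum_log_nonpos _ (fun ω => ?_) ?_
    · have := fiber_card_pos F ω
      have := fiber_card_pos f' ω
      have := fiber_card_pos f ω
      have := fiber_card_pos F' ω
      positivity
    -- Both cardinalities in the numerator are written as counts of points, so that exchanging sums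
    -- leaves sums over single fibres of `F'`.
    · have e1 : ∀ ω, ((fiber F ω).card : ℝ) * (fiber f' ω).card /
          ((fiber f ω).card * (fiber F' ω).card) = ∑ ω', if f' ω = f' ω' then
            ((fiber F ω).card : ℝ) / ((fiber f ω).card * (fiber F' ω).card) else 0 := by
        intro ω
        rw [← sum_filter, sum_const, nsmul_eq_mul]
        have : (univ.filter fun ω' => f' ω = f' ω') = fiber f' ω := by
          ext x; simp [eq_comm]
        rw [this]; ring
      rw [sum_congr rfl fun ω _ => e1 ω, sum_comm]
      have e2 : ∀ ω', (∑ ω, if f' ω = f' ω' then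
            ((fiber F ω).card : ℝ) / ((fiber f ω).card * (fiber F' ω).card) else 0) ≤ 1 := by
        intro ω'
        rw [← sum_filter]
        have e3 : ∀ ω ∈ univ.filter (fun ω => f' ω = f' ω'),
            ((fiber F ω).card : ℝ) / ((fiber f ω).card * (fiber F' ω).card) =
            ((fiber f ω').card : ℝ)⁻¹ * ∑ x ∈ fiber f ω', if g ω = g x then
              ((fiber F' ω).card : ℝ)⁻¹ else 0 := by
          intro ω hω
          have hω : f' ω = f' ω' := by simpa using hω
          rw [← sum_filter, sum_const, nsmul_eq_mul, fiber_congr (h _ _ hω)]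
          have : (fiber f ω').filter (fun x => g ω = g x) = fiber F ω := by
            ext x; simp [F, h _ _ hω, eq_comm]
          rw [this]; field_simp
        rw [sum_congr rfl e3, ← mul_sum, sum_comm]
        have e4 : ∀ x ∈ fiber f ω', (∑ ω ∈ univ.filter (fun ω => f' ω = f' ω'),
            if g ω = g x then ((fiber F' ω).card : ℝ)⁻¹ else 0) ≤ 1 := by
          intro x _
          rw [← sum_filter]
          refine sum_inv_fiber_card_le_one F' _ fun ω hω => ?_
          simp only [mem_filter, mem_univ, true_and] at hω
          ext y; simp [F', hω.1, hω.2]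
        have := sum_le_sum e4
        rw [sum_const, nsmul_eq_mul, mul_one] at this
        rw [inv_mul_le_iff₀ (fiber_card_pos f ω')]
        simpa using this
      have := sum_le_sum fun ω' (_ : ω' ∈ univ) => e2 ω'
      simpa using this
  have e : ∀ ω, Real.log ((fiber F ω).card * (fiber f' ω).card /
      ((fiber f ω).card * (fiber F' ω).card)) =
      (Real.log (Fintype.card Ω) - Real.log (fiber F' ω).card) -
      (Real.log (Fintype.card Ω) - Real.log (fiber f' ω).card) -
      ((Real.log (Fintype.card Ω) - Real.log (fiber F ω).card) -
      (Real.log (Fintype.card Ω) - Real.log (fiber f ω).card)) := by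
    intro ω
    have h1 := (fiber_card_pos F ω).ne'
    have h2 := (fiber_card_pos f' ω).ne'
    have h3 := (fiber_card_pos f ω).ne'
    have h4 := (fiber_card_pos F' ω).ne'
    rw [Real.log_div (by positivity) (by positivity), Real.log_mul h1 h2, Real.log_mul h3 h4]
    ring
  rw [sum_congr rfl fun ω _ => e ω] at key
  rw [sum_sub_distrib (fun ω => _ - _), sum_sub_distrib (fun ω => _ - _),
    sum_sub_distrib (fun ω => _ - _) (fun ω => _ - _)] at key
  unfold entropy
  rw [← sub_nonpos, ← sub_div, ← sub_div, ← sub_div]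
  exact div_nonpos_of_nonpos_of_nonneg key (by positivity)

/-- Gibbs' inequality against the uniform distribution on `T`. -/
lemma entropy_le_log_card (f : Ω → α) (T : Finset α) (hT : ∀ ω, f ω ∈ T) :
    entropy f ≤ Real.log T.card := by
  classical
  rcases isEmpty_or_nonempty Ω with hΩ | ⟨⟨ω₀⟩⟩
  · simp only [entropy, univ_eq_empty, sum_empty, zero_div]
    exact Real.log_natCast_nonneg _
  have hTpos : (0 : ℝ) < T.card := by exact_mod_cast card_pos.mpr ⟨_, hT ω₀⟩
  have hΩpos : (0 : ℝ) < Fintype.card Ω := by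
    exact_mod_cast Fintype.card_pos_iff.mpr ⟨ω₀⟩
  have key : ∑ ω, Real.log (Fintype.card Ω / ((fiber f ω).card * T.card)) ≤ 0 := by
    refine sum_log_nonpos _ (fun ω => ?_) ?_
    · have := fiber_card_pos f ω
      positivity
    · have e1 : ∀ ω, (Fintype.card Ω : ℝ) / ((fiber f ω).card * T.card) =
          (Fintype.card Ω : ℝ) / T.card * ∑ y ∈ T, if f ω = y then
            ((fiber f ω).card : ℝ)⁻¹ else 0 := by
        intro ω
        rw [sum_ite_eq, if_pos (hT ω)]; field_simp
      rw [sum_congr rfl fun ω _ => e1 ω, ← mul_sum, sum_comm]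
      have e2 : ∀ y ∈ T, (∑ ω, if f ω = y then ((fiber f ω).card : ℝ)⁻¹ else 0) ≤ 1 := by
        intro y _
        rw [← sum_filter]
        refine sum_inv_fiber_card_le_one f _ fun ω hω => ?_
        simp only [mem_filter, mem_univ, true_and] at hω
        ext x; simp [hω]
      have := sum_le_sum e2
      rw [sum_const, nsmul_eq_mul, mul_one] at this
      rw [div_mul_eq_mul_div, div_le_iff₀ hTpos]
      gcongr
  have e : ∀ ω, Real.log (Fintype.card Ω / ((fiber f ω).card * T.card)) =
      (Real.log (Fintype.card Ω) - Real.log (fiber f ω).card) - Real.log T.card := by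
    intro ω
    have h1 := (fiber_card_pos f ω).ne'
    rw [Real.log_div hΩpos.ne' (by positivity), Real.log_mul h1 hTpos.ne']
    ring
  rw [sum_congr rfl fun ω _ => e ω, sum_sub_distrib, sum_const, nsmul_eq_mul, card_univ] at key
  unfold entropy
  rw [div_le_iff₀ hΩpos]
  linarith

variable {U V : Type*} [Fintype U] [Fintype V]

/-- A message `v` received through `Y (u, v)`, where `u` is interference of entropy `entropy Z`: if
the observation leaves at most `P` candidates for `v`, then on average
`log (|V| / P) ≤ H(Y) - H(Z)`. -/
lemma sum_log_candidates_le_entropy_sub [Nonempty U] [Nonempty V] (Y : U × V → α) (Z : U → γ)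
    (P : U × V → ℝ) (hP : ∀ ω, 0 < P ω) (hPY : ∀ ω ω', Y ω = Y ω' → P ω = P ω')
    (hZ : ∀ u u' v, Y (u, v) = Y (u', v) ↔ Z u = Z u')
    (C : U × V → Finset V) (hC : ∀ ω u v, Y (u, v) = Y ω → v ∈ C ω)
    (hCP : ∀ ω, (C ω).card ≤ P ω) :
    (∑ ω, (Real.log (Fintype.card V) - Real.log (P ω))) / Fintype.card (U × V) ≤
      entropy Y - entropy Z := by
  classical
  have hUpos : (0 : ℝ) < Fintype.card U := by exact_mod_cast Fintype.card_pos
  have hVpos : (0 : ℝ) < Fintype.card V := by exact_mod_cast Fintype.card_pos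
  have key : ∑ ω, Real.log ((fiber Y ω).card / (P ω * (fiber Z ω.1).card)) ≤ 0 := by
    refine sum_log_nonpos _ (fun ω => ?_) ?_
    · have := fiber_card_pos Y ω
      have := fiber_card_pos Z ω.1
      have := hP ω
      positivity
    -- `P` is constant on fibres of `Y`, so it can be evaluated at `ω'` and pulled out after the
    -- sums are exchanged.
    · have e1 : ∀ ω, ((fiber Y ω).card : ℝ) / (P ω * (fiber Z ω.1).card) =
          ∑ ω', if Y ω = Y ω' then (P ω')⁻¹ * ((fiber Z ω.1).card : ℝ)⁻¹ else 0 := by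
        intro ω
        rw [← sum_filter, sum_congr rfl (g := fun _ => (P ω)⁻¹ * ((fiber Z ω.1).card : ℝ)⁻¹)]
        · rw [sum_const, nsmul_eq_mul]
          have : (univ.filter fun ω' => Y ω = Y ω') = fiber Y ω := by
            ext x; simp [eq_comm]
          rw [this, div_eq_mul_inv, mul_inv]
        · intro x hx
          rw [hPY ω x (by simpa using hx)]
      rw [sum_congr rfl fun ω _ => e1 ω, sum_comm]
      have e2 : ∀ ω', (∑ ω, if Y ω = Y ω' then
          (P ω')⁻¹ * ((fiber Z ω.1).card : ℝ)⁻¹ else 0) ≤ 1 := by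
        intro ω'
        rw [← sum_filter, ← mul_sum, inv_mul_le_iff₀ (hP ω'), mul_one, sum_filter,
          Fintype.sum_prod_type_right]
        refine le_trans ?_ (hCP ω')
        -- For fixed `v`, the `u` producing a given observation form a fibre of `Z` or the empty
        -- set, and only candidates `v` contribute.
        have e3 : ∀ v, (∑ u, if Y (u, v) = Y ω' then ((fiber Z u).card : ℝ)⁻¹ else 0) ≤
            if v ∈ C ω' then 1 else 0 := by
          intro v
          split_ifs with hv
          · rw [← sum_filter]
            refine sum_inv_fiber_card_le_one Z _ fun u hu => ?_
            simp only [mem_filter, mem_univ, true_and] at hu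
            ext x; simp [← hu, ← hZ x u v]
          · refine (sum_eq_zero fun u _ => if_neg fun h => hv (hC _ _ _ h)).le
        refine (sum_le_sum fun v _ => e3 v).trans ?_
        simp
      have := sum_le_sum fun ω' (_ : ω' ∈ univ) => e2 ω'
      simpa using this
  have e : ∀ ω, Real.log ((fiber Y ω).card / (P ω * (fiber Z ω.1).card)) =
      Real.log (fiber Y ω).card - Real.log (P ω) - Real.log (fiber Z ω.1).card := by
    intro ω
    have h2 := (fiber_card_pos Z ω.1).ne'
    rw [Real.log_div (fiber_card_pos Y ω).ne' (mul_ne_zero (hP ω).ne' h2),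
      Real.log_mul (hP ω).ne' h2]
    ring
  have hUV : (Fintype.card (U × V) : ℝ) = Fintype.card U * Fintype.card V := by
    rw [Fintype.card_prod]; push_cast; rfl
  have hZsum : entropy Z = (∑ ω : U × V, (Real.log (Fintype.card U) -
      Real.log (fiber Z ω.1).card)) / Fintype.card (U × V) := by
    rw [Fintype.sum_prod_type, hUV, entropy]
    simp only [sum_const, nsmul_eq_mul, card_univ, ← mul_sum]
    field_simp
  rw [hZsum, entropy, ← sub_div]
  gcongr
  rw [sum_congr rfl fun ω _ => e ω] at key
  rw [← sum_sub_distrib, ← sub_nonpos, ← sum_sub_distrib]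
  refine le_trans (le_of_eq (sum_congr rfl fun ω _ => ?_)) key
  rw [hUV, Real.log_mul hUpos.ne' hVpos.ne']
  ring

/-- If every `u` turns the observation `Y (u, ·)` into a function equivalent to `Z` and leaves at
most `P` candidates for `v`, then on average `log (|V| / P) ≤ H(Z)`. -/
lemma sum_log_candidates_le_entropy [Nonempty U] (Y : U × V → α) (Z : V → γ)
    (P : U × V → ℝ) (hZ : ∀ u v v', Y (u, v) = Y (u, v') ↔ Z v = Z v')
    (C : U × V → Finset V) (hC : ∀ ω u v, Y (u, v) = Y ω → v ∈ C ω)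
    (hCP : ∀ ω, (C ω).card ≤ P ω) :
    (∑ ω, (Real.log (Fintype.card V) - Real.log (P ω))) / Fintype.card (U × V) ≤
      entropy Z := by
  have hUpos : (0 : ℝ) < Fintype.card U := by exact_mod_cast Fintype.card_pos
  have hUV : (Fintype.card (U × V) : ℝ) = Fintype.card U * Fintype.card V := by
    rw [Fintype.card_prod]; push_cast; rfl
  have hZsum : entropy Z = (∑ ω : U × V, (Real.log (Fintype.card V) -
      Real.log (fiber Z ω.2).card)) / Fintype.card (U × V) := by
    rw [Fintype.sum_prod_type, hUV, entropy]
    simp only [sum_const, nsmul_eq_mul, card_univ]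
    field_simp
  rw [hZsum]
  gcongr with ω
  · exact fiber_card_pos Z ω.2
  · refine le_trans ?_ (hCP ω)
    gcongr
    intro v hv
    exact hC ω ω.1 v ((hZ _ _ _).2 (by simpa using hv))

end Entropy

/-! ### Entropy through links with delayed state information -/

section DelayedState

open Finset

variable {S W : Type*} {n : ℕ} {p : S → ℝ}

/-- Under a product weight, a function of the `t`-th coordinate is independent of a function of the
other coordinates. -/
lemma sum_prod_weight_mul [Fintype S] (hp : ∑ v, p v = 1) (t : Fin n) (φ : S → ℝ)
    (G : (Fin n → S) → ℝ)
    (hG : ∀ s v, G (Function.update s t v) = G s) :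
    ∑ s : Fin n → S, (∏ r, p (s r)) * (φ (s t) * G s) =
      (∑ v, p v * φ v) * ∑ s : Fin n → S, (∏ r, p (s r)) * G s := by
  classical
  have hprod : ∀ (s : Fin n → S) (v : S),
      (∏ r, p (Function.update s t v r)) * p (s t) = (∏ r, p (s r)) * p v := by
    intro s v
    rw [Fintype.prod_eq_mul_prod_compl t, Fintype.prod_eq_mul_prod_compl t (fun r => p (s r))]
    rw [prod_congr rfl (g := fun r => p (s r))]
    · simp; ring
    · intro r hr
      rw [Function.update_of_ne (by simpa using hr)]
  -- Adjoin an independent copy of the `t`-th coordinate and exchange the two: the weight is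
  -- symmetric and `G` does not notice.
  calc ∑ s : Fin n → S, (∏ r, p (s r)) * (φ (s t) * G s)
      = ∑ x : (Fin n → S) × S, (∏ r, p (x.1 r)) * p x.2 * (φ (x.1 t) * G x.1) := by
        rw [Fintype.sum_prod_type]
        refine sum_congr rfl fun s _ => ?_
        simp only
        rw [← sum_mul, ← mul_sum, hp, mul_one]
    _ = ∑ x : (Fin n → S) × S, (∏ r, p (x.1 r)) * p x.2 * (φ x.2 * G x.1) := by
        refine sum_bij' (fun x _ => (Function.update x.1 t x.2, x.1 t))
          (fun x _ => (Function.update x.1 t x.2, x.1 t)) (by simp) (by simp)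
          (by simp) (by simp) ?_
        rintro ⟨s, v⟩ _
        simp only [hG, hprod]
    _ = _ := by
        rw [Fintype.sum_prod_type, mul_sum]
        refine sum_congr rfl fun s _ => ?_
        rw [sum_mul]
        exact sum_congr rfl fun v _ => by ring

lemma sum_prod_weight [Fintype S] (hp : ∑ v, p v = 1) : ∑ s : Fin n → S, ∏ r, p (s r) = 1 := by
  classical
  rw [← Fintype.piFinset_univ, ← prod_univ_sum (fun _ => univ) (fun _ => p)]
  simp [hp]

/-- The part of the signals `x` in the first `τ` slots that a link with gain `m` lets through. -/
def observed (x : Fin n → (Fin n → S) → W → Bool) (m : S → Bool) (s : Fin n → S) (τ : ℕ)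
    (w : W) (r : Fin n) : Bool :=
  decide (r.val < τ) && (m (s r) && x r s w)

/-- The mean entropy of what a link with gain `m` lets through in the first `τ` slots. -/
noncomputable def meanEntropy [Fintype S] [Fintype W] (p : S → ℝ)
    (x : Fin n → (Fin n → S) → W → Bool) (m : S → Bool)
    (τ : ℕ) : ℝ :=
  ∑ s : Fin n → S, (∏ r, p (s r)) * entropy (observed x m s τ)

/-- The entropy of the signal of slot `t` given what has been observed before. -/
noncomputable def signalEntropy [Fintype W] (x : Fin n → (Fin n → S) → W → Bool) (m : S → Bool)
    (s : Fin n → S) (t : Fin n) : ℝ :=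
  entropy (fun w => (observed x m s t w, x t s w)) - entropy (observed x m s t)

variable {x : Fin n → (Fin n → S) → W → Bool}

/-- Slots before `t` involve only states before `t`, and the remaining slots are masked. -/
lemma observed_update [DecidableEq (Fin n)]
    (hx : ∀ t s s', (∀ r < t, s r = s' r) → x t s = x t s') (m : S → Bool)
    (s : Fin n → S) (t : Fin n) (v : S) :
    observed x m (Function.update s t v) t = observed x m s t := by
  funext w r
  unfold observed
  by_cases hr : r < t
  · rw [Function.update_of_ne hr.ne,
      hx r (Function.update s t v) s fun q hq => Function.update_of_ne (hq.trans hr).ne _ _]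
  · have : ¬ r.val < t.val := hr
    simp [this]

lemma observed_succ_eq_iff (m : S → Bool) (s : Fin n → S) (t : Fin n) (w w' : W) :
    observed x m s (t + 1) w = observed x m s (t + 1) w' ↔
      observed x m s t w = observed x m s t w' ∧
        (m (s t) = true → x t s w = x t s w') := by
  simp only [funext_iff, observed]
  constructor
  · refine fun h => ⟨fun r => ?_, fun hm => ?_⟩
    · have := h r
      by_cases hr : r.val < t.val
      · have h2 : r.val < t.val + 1 := by omega
        simpa [hr, h2] using this
      · simp [hr]
    · simpa [hm] using h t
  · rintro ⟨h1, h2⟩ r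
    by_cases hr : r.val < t.val
    · have h3 : r.val < t.val + 1 := by omega
      simpa [hr, h3] using h1 r
    · by_cases hr' : r = t
      · subst hr'
        by_cases hm : m (s r) = true
        · simp [hm, h2 hm]
        · simp [hm]
      · have h3 : ¬ r.val < t.val + 1 := fun h => hr' (Fin.ext (by omega))
        simp [h3]

lemma entropy_observed_succ [Fintype W] (m : S → Bool) (s : Fin n → S) (t : Fin n) :
    entropy (observed x m s (t + 1)) =
      entropy (observed x m s t) + (if m (s t) then 1 else 0) * signalEntropy x m s t := by
  unfold signalEntropy
  by_cases hm : m (s t) = true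
  · rw [if_pos hm, one_mul, add_sub_cancel]
    refine entropy_congr fun w w' => ?_
    rw [observed_succ_eq_iff, Prod.mk.injEq]
    simp [hm]
  · rw [if_neg hm, zero_mul, add_zero]
    refine entropy_congr fun w w' => ?_
    rw [observed_succ_eq_iff]
    simp [hm]

/-- The chain rule. Delay enters here: the conditional entropy of the signal of slot `t` does not
depend on the state of that slot, so the link probability factors out. -/
lemma meanEntropy_succ [Fintype S] [Fintype W] (hp : ∑ v, p v = 1)
    (hx : ∀ t s s', (∀ r < t, s r = s' r) → x t s = x t s') (m : S → Bool) (t : Fin n) :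
    meanEntropy p x m (t + 1) = meanEntropy p x m t + (∑ v, p v * if m v then 1 else 0) *
      ∑ s : Fin n → S, (∏ r, p (s r)) * signalEntropy x m s t := by
  unfold meanEntropy
  rw [← sum_prod_weight_mul hp t, ← sum_add_distrib]
  · refine sum_congr rfl fun s _ => ?_
    rw [entropy_observed_succ, mul_add]
  · intro s v
    unfold signalEntropy
    rw [observed_update hx, hx t (Function.update s t v) s
      fun q hq => Function.update_of_ne hq.ne _ _]

lemma observed_zero (m : S → Bool) (s : Fin n → S) (w w' : W) :
    observed x m s 0 w = observed x m s 0 w' := by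
  funext r
  simp [observed]

lemma entropy_observed_mono [Fintype W] {m m' : S → Bool} (hm : ∀ v, m v = true → m' v = true)
    (s : Fin n → S) (τ : ℕ) : entropy (observed x m s τ) ≤ entropy (observed x m' s τ) := by
  refine entropy_mono fun w w' h => funext fun r => ?_
  have := congr_fun h r
  unfold observed at this ⊢
  by_cases h1 : m (s r) = true
  · simpa [h1, hm _ h1] using this
  · simp [h1]

lemma meanEntropy_mono [Fintype S] [Fintype W] (hp0 : ∀ v, 0 ≤ p v) {m m' : S → Bool}
    (hm : ∀ v, m v = true → m' v = true) (τ : ℕ) :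
    meanEntropy p x m τ ≤ meanEntropy p x m' τ :=
  sum_le_sum fun s _ => mul_le_mul_of_nonneg_left (entropy_observed_mono hm s τ)
    (prod_nonneg fun _ _ => hp0 _)

/-- Delayed state information: the entropy per unit of link probability that passes through a link
is at least that which passes through a stronger link. -/
theorem meanEntropy_le_of_delayed [Fintype S] [Fintype W] (hp0 : ∀ v, 0 ≤ p v) (hp : ∑ v, p v = 1)
    (hx : ∀ t s s', (∀ r < t, s r = s' r) → x t s = x t s') {m m' : S → Bool}
    (hm : ∀ v, m v = true → m' v = true) :
    (∑ v, p v * if m v then 1 else 0) * meanEntropy p x m' n ≤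
      (∑ v, p v * if m' v then 1 else 0) * meanEntropy p x m n := by
  set q := ∑ v, p v * if m v then (1 : ℝ) else 0
  set q' := ∑ v, p v * if m' v then (1 : ℝ) else 0
  have hq : 0 ≤ q := sum_nonneg fun v _ => mul_nonneg (hp0 v) (by split_ifs <;> simp)
  have hq' : 0 ≤ q' := sum_nonneg fun v _ => mul_nonneg (hp0 v) (by split_ifs <;> simp)
  have main : ∀ τ ≤ n, q * meanEntropy p x m' τ ≤ q' * meanEntropy p x m τ := by
    intro τ
    induction τ with
    | zero =>
      intro _
      have : ∀ s : Fin n → S, entropy (observed x m s 0) = entropy (observed x m' s 0) :=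
        fun s => entropy_congr fun w w' =>
          ⟨fun _ => observed_zero _ _ _ _, fun _ => observed_zero _ _ _ _⟩
      have h0 : ∀ s : Fin n → S, entropy (observed x m s 0) = 0 := by
        intro s
        unfold entropy
        have : ∀ w, fiber (observed x m s 0) w = univ := fun w => by
          ext w'; simp [observed_zero m s w' w]
        simp [this]
      simp [meanEntropy, ← this, h0]
    | succ τ ih =>
      intro hτ
      have h1 := meanEntropy_succ hp hx m ⟨τ, hτ⟩
      have h2 := meanEntropy_succ hp hx m' ⟨τ, hτ⟩
      simp only at h1 h2
      rw [h1, h2, mul_add, mul_add, mul_left_comm q q']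
      -- Both increments carry the factor `q' * q`. What passes `m'` determines what passes `m`, so
      -- the signal entropy given the former is smaller.
      gcongr ?_ + ?_
      · exact ih (by omega)
      · gcongr with s
        · exact prod_nonneg fun r _ => hp0 _
        · refine entropy_pair_sub_le _ fun w w' h => ?_
          funext r
          have := congr_fun h r
          unfold observed at this ⊢
          by_cases h1 : m (s r) = true
          · simpa [h1, hm _ h1] using this
          · simp [h1]
  exact main n le_rfl

lemma card_support_subset_le {T : Finset (Fin n)} :
    (univ.filter fun y : Fin n → Bool => ∀ r ∉ T, y r = false).card ≤ 2 ^ T.card := by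
  classical
  have : (univ.filter fun y : Fin n → Bool => ∀ r ∉ T, y r = false) ⊆
      Fintype.piFinset fun r => if r ∈ T then univ else {false} := by
    intro y hy
    simp only [mem_filter, mem_univ, true_and] at hy
    rw [Fintype.mem_piFinset]
    intro r
    by_cases hr : r ∈ T
    · simp [hr]
    · simp [hr, hy r hr]
  refine (card_le_card this).trans ?_
  rw [Fintype.card_piFinset]
  simp only [apply_ite card, card_univ, Fintype.card_bool, card_singleton]
  rw [prod_ite, prod_const, prod_const_one, mul_one]
  simp

/-- A binary sequence that vanishes outside the slots in which a link is on has entropy at most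
one bit for each such slot. -/
lemma entropy_le_card_mul_log_two [Fintype W] (m : S → Bool) (s : Fin n → S) (f : W → Fin n → Bool)
    (hf : ∀ w r, m (s r) = false → f w r = false) :
    entropy f ≤ (∑ r, if m (s r) then 1 else 0) * Real.log 2 := by
  classical
  set T : Finset (Fin n) := univ.filter fun r => m (s r) = true
  have h := entropy_le_log_card f
    (univ.filter fun y : Fin n → Bool => ∀ r ∉ T, y r = false) (fun w => by
      simp only [mem_filter, mem_univ, true_and]
      intro r hr
      exact hf w r (by simpa [T] using hr))
  have hT : (∑ r, if m (s r) then (1 : ℝ) else 0) = T.card := by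
    rw [sum_boole]
  rw [hT, ← Real.log_pow]
  rcases isEmpty_or_nonempty W with hW | ⟨⟨w⟩⟩
  · have : entropy f = 0 := by simp [entropy]
    rw [this, Real.log_pow]
    positivity
  refine h.trans ?_
  have hpos : 0 < (univ.filter fun y : Fin n → Bool => ∀ r ∉ T, y r = false).card :=
    card_pos.mpr ⟨fun _ => false, by simp⟩
  gcongr
  exact_mod_cast card_support_subset_le

/-- The expected number of slots in which a link is on. -/
lemma sum_prod_weight_mul_count [Fintype S] (hp : ∑ v, p v = 1) (m : S → Bool) :
    ∑ s : Fin n → S, (∏ r, p (s r)) * ∑ r, (if m (s r) then (1 : ℝ) else 0) =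
      n * ∑ v, p v * if m v then 1 else 0 := by
  have h : ∀ t : Fin n, ∑ s : Fin n → S, (∏ r, p (s r)) * (if m (s t) then (1 : ℝ) else 0) =
      ∑ v, p v * if m v then 1 else 0 := by
    intro t
    have := sum_prod_weight_mul hp t (fun v => if m v then (1 : ℝ) else 0) (fun _ => 1)
      fun _ _ => rfl
    simpa only [mul_one, sum_prod_weight hp] using this
  simp only [mul_sum]
  rw [sum_comm]
  simp only [h, sum_const, card_univ, Fintype.card_fin, nsmul_eq_mul, mul_sum]

end DelayedState

/-! ### The two users and the law of a single slot -/

lemma other_ne (i : Fin 2) : other i ≠ i := by fin_cases i <;> decide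

lemma other_other (i : Fin 2) : other (other i) = i := by fin_cases i <;> decide

lemma eq_or_eq_other (i j : Fin 2) : j = i ∨ j = other i := by
  fin_cases i <;> fin_cases j <;> decide

section Slot

/-- The law of the four link states in one slot. -/
noncomputable def slotLaw (δ : Erasures) : Measure ChannelState :=
  Measure.pi fun i => Measure.pi fun j =>
    bernoulliMeasure true false (unitInterval.symm (δ i j))

instance (δ : Erasures) : IsProbabilityMeasure (slotLaw δ) := by
  unfold slotLaw; infer_instance

instance (δ : Erasures) (n : ℕ) : IsProbabilityMeasure (channelLaw δ n) := by
  unfold channelLaw; infer_instance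

lemma channelLaw_real_singleton (δ : Erasures) (n : ℕ) (s : Fin n → ChannelState) :
    (channelLaw δ n).real {s} = ∏ t, (slotLaw δ).real {s t} := by
  change (Measure.pi fun _ => slotLaw δ).real {s} = _
  simp only [Measure.real, Measure.pi_singleton, ENNReal.toReal_prod]

lemma sum_slotLaw (δ : Erasures) : ∑ v, (slotLaw δ).real {v} = 1 := by
  rw [sum_measureReal_singleton]; simp

/-- Passing to the complement turns "some link is on" into "all these links are off", a box whose
probability factors. -/
lemma sum_slotLaw_mul_ite (δ : Erasures) (m : ChannelState → Bool) :
    ∑ v, (slotLaw δ).real {v} * (if m v then (1 : ℝ) else 0) =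
      1 - (slotLaw δ).real {v | m v = false} := by
  classical
  simp only [mul_ite, mul_one, mul_zero]
  rw [← Finset.sum_filter, sum_measureReal_singleton, ← probReal_compl_eq_one_sub]
  · congr 1
    ext v; simp
  · exact (Set.toFinite _).measurableSet

lemma slotLaw_real_pi (δ : Erasures) (A : Fin 2 → Fin 2 → Set Bool) :
    (slotLaw δ).real {v | ∀ i j, v i j ∈ A i j} =
      ∏ i, ∏ j, (bernoulliMeasure true false (unitInterval.symm (δ i j))).real (A i j) := by
  have : {v : ChannelState | ∀ i j, v i j ∈ A i j} =
      Set.univ.pi fun i => Set.univ.pi fun j => A i j := by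
    ext v; simp
  simp only [this, slotLaw, Measure.real, Measure.pi_pi, ENNReal.toReal_prod]

/-- The probability that a link is on. -/
lemma sum_slotLaw_link (δ : Erasures) (i j : Fin 2) :
    ∑ v, (slotLaw δ).real {v} * (if v i j then (1 : ℝ) else 0) = 1 - δ i j := by
  rw [sum_slotLaw_mul_ite δ fun v => v i j]
  have := slotLaw_real_pi δ fun k l => if k = i ∧ l = j then {false} else Set.univ
  have h : {v : ChannelState | v i j = false} = {v | ∀ k l, v k l ∈
      (if k = i ∧ l = j then {false} else Set.univ : Set Bool)} := by
    ext v
    simp only [Set.mem_ofPred_eq]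
    refine ⟨fun hv k l => ?_, fun hv => by simpa using hv i j⟩
    split_ifs with hkl
    · simp [hkl.1, hkl.2, hv]
    · trivial
  rw [h, this]
  fin_cases i <;> fin_cases j <;> simp

/-- The probability that at least one of two distinct links is on. -/
lemma sum_slotLaw_link_or (δ : Erasures) {i j i' j' : Fin 2} (hne : (i, j) ≠ (i', j')) :
    ∑ v, (slotLaw δ).real {v} * (if (v i j || v i' j') then (1 : ℝ) else 0) =
      1 - δ i j * δ i' j' := by
  rw [sum_slotLaw_mul_ite δ fun v => v i j || v i' j']
  have := slotLaw_real_pi δ fun k l =>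
    if (k = i ∧ l = j) ∨ (k = i' ∧ l = j') then {false} else Set.univ
  have h : {v : ChannelState | (v i j || v i' j') = false} = {v | ∀ k l, v k l ∈
      (if (k = i ∧ l = j) ∨ (k = i' ∧ l = j') then {false} else Set.univ : Set Bool)} := by
    ext v
    simp only [Set.mem_ofPred_eq, Bool.or_eq_false_iff]
    refine ⟨fun hv k l => ?_, fun hv => ⟨by simpa using hv i j, by simpa using hv i' j'⟩⟩
    split_ifs with hkl
    · rcases hkl with ⟨rfl, rfl⟩ | ⟨rfl, rfl⟩
      · exact hv.1
      · exact hv.2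
    · trivial
  rw [h, this]
  fin_cases i <;> fin_cases j <;> fin_cases i' <;> fin_cases j' <;>
    first
    | exact absurd rfl hne
    | simp [mul_comm]

end Slot

/-! ### Decoded bits for fixed arrivals and link states -/

section Messages

open Finset

variable {n : ℕ} (c : Scheme n) (s : Fin n → ChannelState) (a : Fin 2 → Fin n → ℕ)

/-- The values of the bits that arrive at user `i` during the `n` slots. -/
abbrev Message (a : Fin 2 → Fin n → ℕ) (i : Fin 2) := Fin (∑ t, a i t) → Bool

/-- A finite bit string, continued by zeros. -/
def extend {N : ℕ} (w : Fin N → Bool) (k : ℕ) : Bool := if h : k < N then w ⟨k, h⟩ else false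

@[simp] lemma extend_val {N : ℕ} (w : Fin N → Bool) (k : Fin N) : extend w k = w k := by
  simp [extend]

/-- The signal of user `i` as a function of the link states and of its own message. -/
def signal (i : Fin 2) (t : Fin n) (s : Fin n → ChannelState) (w : Message a i) : Bool :=
  -- The string `w` is supplied for both users, but `sent` for user `i` reads only component `i`.
  sent c s a (fun _ => extend w) i t

/-- What receiver `i` receives, as a function of both messages. -/
def output (i : Fin 2) (ω : ∀ j, Message a j) : Fin n → Bool :=
  received c s a (fun j => extend (ω j)) i

/-- The number of decodable bits, as a function of both messages. -/
noncomputable def decodedCount (i : Fin 2) (ω : ∀ j, Message a j) : ℕ :=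
  numDecodable c s a (fun j => extend (ω j)) i

variable {c s a}

lemma signal_congr (i : Fin 2) (t : Fin n) (s s' : Fin n → ChannelState)
    (h : ∀ r < t, s r = s' r) : signal c a i t s = signal c a i t s' := by
  funext w
  unfold signal sent
  congr 1
  funext r
  exact h _ (Fin.lt_def.2 r.isLt)

lemma output_apply (i : Fin 2) (ω : ∀ j, Message a j) (t : Fin n) :
    output c s a i ω t = xor (s t i i && signal c a i t s (ω i))
      (s t (other i) i && signal c a (other i) t s (ω (other i))) := rfl

lemma sum_arrivals_le (i : Fin 2) (t : Fin n) :
    ∑ r : Fin (t + 1), a i (r.castLE t.isLt) ≤ ∑ r, a i r := by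
  have : ∑ r : Fin (t + 1), a i (r.castLE t.isLt) =
      ∑ r ∈ univ.map (Fin.castLEEmb t.isLt), a i r := by
    rw [sum_map]; rfl
  rw [this]
  exact sum_le_sum_of_subset (subset_univ _)

lemma received_congr {b b' : Fin 2 → ℕ → Bool} (h : ∀ j, ∀ k < ∑ t, a j t, b j k = b' j k)
    (i : Fin 2) (t : Fin n) : received c s a b i t = received c s a b' i t := by
  have hs : ∀ j, sent c s a b j t = sent c s a b' j t := by
    intro j
    unfold sent
    congr 1
    funext k
    exact h j k (k.isLt.trans_le (sum_arrivals_le j t))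
  simp only [received, hs]

lemma Decodable.congr {b b' : Fin 2 → ℕ → Bool} {i : Fin 2} {k : ℕ}
    (h : ∀ t, received c s a b' i t = received c s a b i t) (hd : Decodable c s a b i k) :
    Decodable c s a b' i k := fun b'' hb'' => by
  rw [hd b'' fun t => (hb'' t).trans (h t), hd b' h]

lemma numDecodable_congr_received {b b' : Fin 2 → ℕ → Bool} {i : Fin 2}
    (h : ∀ t, received c s a b' i t = received c s a b i t) :
    numDecodable c s a b i = numDecodable c s a b' i := by
  unfold numDecodable
  congr 1
  ext k
  simp only [mem_filter]
  exact and_congr_right fun _ => ⟨Decodable.congr h, Decodable.congr fun t => (h t).symm⟩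

lemma numDecodable_congr {b b' : Fin 2 → ℕ → Bool} (h : ∀ j, ∀ k < ∑ t, a j t, b j k = b' j k)
    (i : Fin 2) : numDecodable c s a b i = numDecodable c s a b' i :=
  numDecodable_congr_received fun t => (received_congr h i t).symm

/-- Bits beyond the arrivals are never transmitted, so infinite bit sequences can be replaced by
finite messages. -/
lemma numDecodable_eq_decodedCount (b : Fin 2 → ℕ → Bool) (i : Fin 2) :
    numDecodable c s a b i = decodedCount c s a i fun j k => b j k := by
  refine numDecodable_congr (fun j k hk => ?_) i
  simp [extend, hk]

open scoped Classical in
/-- The messages of user `i` that are compatible with its decoded bits. -/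
noncomputable def candidates (c : Scheme n) (s : Fin n → ChannelState) (a : Fin 2 → Fin n → ℕ)
    (i : Fin 2) (ω : ∀ j, Message a j) : Finset (Message a i) :=
  univ.filter fun v => ∀ k : Fin (∑ t, a i t),
    Decodable c s a (fun j => extend (ω j)) i k → v k = ω i k

lemma mem_candidates {i : Fin 2} {ω ω' : ∀ j, Message a j}
    (h : output c s a i ω' = output c s a i ω) : ω' i ∈ candidates c s a i ω := by
  simp only [candidates, mem_filter, mem_univ, true_and]
  intro k hk
  simpa using hk (fun j => extend (ω' j)) fun t => congr_fun h t

/-- Decoded positions are frozen and all others are free. -/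
lemma candidates_card (i : Fin 2) (ω : ∀ j, Message a j) :
    (candidates c s a i ω).card * 2 ^ decodedCount c s a i ω = 2 ^ (∑ t, a i t) := by
  classical
  have hK : decodedCount c s a i ω = (univ.filter fun k : Fin (∑ t, a i t) =>
      Decodable c s a (fun j => extend (ω j)) i k).card := by
    unfold decodedCount numDecodable
    rw [← card_map Fin.valEmbedding]
    congr 1
    ext k
    simp only [mem_filter, mem_range, Finset.mem_map, mem_univ, true_and, Fin.valEmbedding_apply]
    exact ⟨fun h => ⟨⟨k, h.1⟩, h.2, rfl⟩, fun ⟨k', h, e⟩ => e ▸ ⟨k'.isLt, h⟩⟩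
  have hC : candidates c s a i ω = Fintype.piFinset fun k : Fin (∑ t, a i t) =>
      if Decodable c s a (fun j => extend (ω j)) i k then {ω i k} else univ := by
    ext v
    simp only [candidates, mem_filter, mem_univ, true_and, Fintype.mem_piFinset]
    refine forall_congr' fun k => ?_
    split_ifs with h <;> simp [h]
  rw [hK, hC, Fintype.card_piFinset]
  simp only [apply_ite card, card_univ, Fintype.card_bool, card_singleton]
  rw [prod_ite, prod_const_one, one_mul, prod_const, ← pow_add, add_comm,
    card_filter_add_card_filter_not, card_univ, Fintype.card_fin]

/-- Separate the message of user `i` from that of its interferer. -/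
noncomputable def messagePair (a : Fin 2 → Fin n → ℕ) (i : Fin 2) :
    Message a (other i) × Message a i ≃ ∀ j, Message a j :=
  Equiv.symm <| Equiv.ofBijective (fun ω => (ω (other i), ω i)) <| by
    constructor
    · intro ω ω' h
      simp only [Prod.mk.injEq] at h
      funext j
      rcases eq_or_eq_other i j with rfl | rfl
      exacts [h.2, h.1]
    · rintro ⟨u, v⟩
      refine ⟨Function.update (Function.update (fun _ _ => false) i v) (other i) u, ?_⟩
      simp [Function.update_of_ne (other_ne i).symm]

@[simp] lemma messagePair_other (i : Fin 2) (x : Message a (other i) × Message a i) :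
    messagePair a i x (other i) = x.1 :=
  congr_arg Prod.fst ((messagePair a i).symm_apply_apply x)

@[simp] lemma messagePair_self (i : Fin 2) (x : Message a (other i) × Message a i) :
    messagePair a i x i = x.2 :=
  congr_arg Prod.snd ((messagePair a i).symm_apply_apply x)

/-- The number of decoded bits, averaged over the messages. -/
noncomputable def meanDecoded (c : Scheme n) (s : Fin n → ChannelState) (a : Fin 2 → Fin n → ℕ)
    (i : Fin 2) : ℝ :=
  (∑ ω : ∀ j, Message a j, (decodedCount c s a i ω : ℝ)) / Fintype.card (∀ j, Message a j)

/-- The number of messages of user `i` compatible with its decoded bits. -/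
noncomputable def ambiguity (c : Scheme n) (s : Fin n → ChannelState) (a : Fin 2 → Fin n → ℕ)
    (i : Fin 2) (x : Message a (other i) × Message a i) : ℝ :=
  (candidates c s a i (messagePair a i x)).card

lemma ambiguity_mul (i : Fin 2) (x : Message a (other i) × Message a i) :
    ambiguity c s a i x * 2 ^ decodedCount c s a i (messagePair a i x) = 2 ^ (∑ t, a i t) := by
  unfold ambiguity
  exact_mod_cast candidates_card i (messagePair a i x)

lemma ambiguity_pos (i : Fin 2) (x : Message a (other i) × Message a i) :
    0 < ambiguity c s a i x := by
  have h := ambiguity_mul (c := c) (s := s) i x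
  have h2 : (0 : ℝ) < 2 ^ (∑ t, a i t) := by positivity
  rw [← h] at h2
  exact pos_of_mul_pos_left h2 (by positivity)

/-- Puts the decoded count in the form bounded by the two candidate estimates for entropy. -/
lemma meanDecoded_mul_log_two (i : Fin 2) :
    meanDecoded c s a i * Real.log 2 =
      (∑ x, (Real.log (Fintype.card (Message a i)) - Real.log (ambiguity c s a i x))) /
        Fintype.card (Message a (other i) × Message a i) := by
  unfold meanDecoded
  rw [← Fintype.card_congr (messagePair a i), ← (messagePair a i).sum_comp, div_mul_eq_mul_div,
    sum_mul]
  congr 1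
  refine sum_congr rfl fun x _ => ?_
  have h : (Fintype.card (Message a i) : ℝ) = 2 ^ (∑ t, a i t) := by simp
  rw [h, ← ambiguity_mul (c := c) (s := s) i x,
    Real.log_mul (ambiguity_pos i x).ne' (by positivity), Real.log_pow]
  ring

/-- What receiver `i` receives, as a function of the pair of messages. -/
def pairOutput (c : Scheme n) (s : Fin n → ChannelState) (a : Fin 2 → Fin n → ℕ) (i : Fin 2)
    (x : Message a (other i) × Message a i) (t : Fin n) : Bool :=
  xor (s t i i && signal c a i t s x.2) (s t (other i) i && signal c a (other i) t s x.1)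

lemma output_messagePair (i : Fin 2) (x : Message a (other i) × Message a i) :
    output c s a i (messagePair a i x) = pairOutput c s a i x := by
  funext t
  simp [output_apply, pairOutput]

lemma mem_candidates_pair {i : Fin 2} {x y : Message a (other i) × Message a i}
    (h : pairOutput c s a i y = pairOutput c s a i x) :
    y.2 ∈ candidates c s a i (messagePair a i x) := by
  have := mem_candidates (c := c) (s := s) (i := i) (ω := messagePair a i x)
    (ω' := messagePair a i y) (by rw [output_messagePair, output_messagePair, h])
  simpa using this

lemma ambiguity_congr {i : Fin 2} {x y : Message a (other i) × Message a i}
    (h : pairOutput c s a i x = pairOutput c s a i y) :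
    ambiguity c s a i x = ambiguity c s a i y := by
  have h1 : decodedCount c s a i (messagePair a i x) = decodedCount c s a i (messagePair a i y) :=
    numDecodable_congr_received fun t => by
      rw [← output_messagePair, ← output_messagePair] at h
      exact (congr_fun h t).symm
  have hx := ambiguity_mul (c := c) (s := s) i x
  have hy := ambiguity_mul (c := c) (s := s) i y
  rw [h1, ← hy] at hx
  exact mul_right_cancel₀ (by positivity) hx

variable (c s a) in
/-- Without interference, user `i` conveys at most the entropy that its direct link lets through. -/
lemma meanDecoded_le_entropy_direct (i : Fin 2) :
    meanDecoded c s a i * Real.log 2 ≤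
      entropy (observed (signal c a i) (fun v => v i i) s n) := by
  rw [meanDecoded_mul_log_two]
  refine sum_log_candidates_le_entropy (pairOutput c s a i) _ _ (fun u v v' => ?_)
    (fun x => candidates c s a i (messagePair a i x)) (fun x u v h => mem_candidates_pair h)
    fun x => le_rfl
  -- For a known interferer message, the interference cancels from both sides of the equation.
  simp [funext_iff, pairOutput, observed]

variable (c s a) in
/-- The entropy of the interference is lost to user `i`. -/
lemma meanDecoded_le_entropy_sub (i : Fin 2) :
    meanDecoded c s a i * Real.log 2 ≤
      (∑ t, if (s t i i || s t (other i) i) then 1 else 0) * Real.log 2 -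
        entropy (observed (signal c a (other i)) (fun v => v (other i) i) s n) := by
  rw [meanDecoded_mul_log_two]
  refine (sum_log_candidates_le_entropy_sub (pairOutput c s a i)
    (observed (signal c a (other i)) (fun v => v (other i) i) s n) _ (ambiguity_pos i)
    (fun _ _ => ambiguity_congr) (fun u u' v => ?_)
    (fun x => candidates c s a i (messagePair a i x)) (fun x u v h => mem_candidates_pair h)
    fun x => le_rfl).trans ?_
  -- For a fixed own message, the direct signal cancels and only the interference is left.
  · simp [funext_iff, pairOutput, observed]
  · refine sub_le_sub_right (entropy_le_card_mul_log_two (fun v => v i i || v (other i) i) s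
      (pairOutput c s a i) fun x t h => ?_) _
    simp only [Bool.or_eq_false_iff] at h
    simp [pairOutput, h.1, h.2]

end Messages

/-! ### Averaging over the link states -/

section Mean

open Finset

variable {n : ℕ} (δ : Erasures) (c : Scheme n) (a : Fin 2 → Fin n → ℕ)

/-- The number of decoded bits, averaged over the link states and the messages. -/
noncomputable def avgDecoded (i : Fin 2) : ℝ :=
  ∑ s, (channelLaw δ n).real {s} * meanDecoded c s a i

lemma avgDecoded_mul_log_two_le (i : Fin 2) : avgDecoded δ c a i * Real.log 2 ≤
    meanEntropy (fun v => (slotLaw δ).real {v}) (signal c a i) (fun v => v i i) n := by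
  unfold avgDecoded meanEntropy
  rw [sum_mul]
  refine sum_le_sum fun s _ => ?_
  rw [channelLaw_real_singleton, mul_assoc]
  exact mul_le_mul_of_nonneg_left (meanDecoded_le_entropy_direct c s a i)
    (prod_nonneg fun _ _ => measureReal_nonneg)

lemma meanEntropy_direct_le (i : Fin 2) :
    meanEntropy (fun v => (slotLaw δ).real {v}) (signal c a i) (fun v => v i i) n ≤
      n * (1 - δ i i) * Real.log 2 := by
  have h := sum_prod_weight_mul_count (n := n) (sum_slotLaw δ) fun v => v i i
  rw [sum_slotLaw_link] at h
  rw [← h, sum_mul, meanEntropy]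
  refine sum_le_sum fun s _ => ?_
  rw [mul_assoc]
  refine mul_le_mul_of_nonneg_left ?_ (prod_nonneg fun _ _ => measureReal_nonneg)
  exact entropy_le_card_mul_log_two (fun v => v i i) s
    (observed (signal c a i) (fun v => v i i) s n) fun w r hr => by simp [observed, hr]

/-- The bound on a single user. -/
lemma avgDecoded_le (i : Fin 2) : avgDecoded δ c a i ≤ n * (1 - δ i i) :=
  le_of_mul_le_mul_right ((avgDecoded_mul_log_two_le δ c a i).trans (meanEntropy_direct_le δ c a i))
    (Real.log_pos one_lt_two)

lemma avgDecoded_mul_log_two_le_sub (i : Fin 2) : avgDecoded δ c a i * Real.log 2 ≤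
    n * (1 - δ i i * δ (other i) i) * Real.log 2 -
    meanEntropy (fun v => (slotLaw δ).real {v}) (signal c a (other i))
      (fun v => v (other i) i) n := by
  have h := sum_prod_weight_mul_count (n := n) (sum_slotLaw δ) fun v => v i i || v (other i) i
  rw [sum_slotLaw_link_or δ (by simp [(other_ne i).symm])] at h
  unfold avgDecoded meanEntropy
  rw [← h, sum_mul, sum_mul, ← sum_sub_distrib]
  refine sum_le_sum fun s _ => ?_
  rw [channelLaw_real_singleton, mul_assoc, mul_assoc, ← mul_sub]
  exact mul_le_mul_of_nonneg_left (meanDecoded_le_entropy_sub c s a i)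
    (prod_nonneg fun _ _ => measureReal_nonneg)

/-- The bound on both users, before division by `1 - δ i (other i)`. -/
lemma avgDecoded_add_le (i : Fin 2) :
    (1 - δ i (other i)) * avgDecoded δ c a i +
      (1 - δ i i * δ i (other i)) * avgDecoded δ c a (other i) ≤
    n * ((1 - δ i i * δ i (other i)) * (1 - δ (other i) (other i) * δ i (other i))) := by
  have h1 := avgDecoded_mul_log_two_le δ c a i
  -- At receiver `other i`, user `i` is the interferer.
  have h2 := avgDecoded_mul_log_two_le_sub δ c a (other i)
  rw [other_other] at h2
  have hx : ∀ t s s', (∀ r < t, s r = s' r) → signal c a i t s = signal c a i t s' :=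
    signal_congr i
  have h3 := meanEntropy_le_of_delayed (p := fun v => (slotLaw δ).real {v})
    (fun _ => measureReal_nonneg) (sum_slotLaw δ) hx (m := fun v => v i (other i))
    (m' := fun v => v i i || v i (other i))
    (fun v hv => by simp [show v i (other i) = true from hv])
  rw [sum_slotLaw_link, sum_slotLaw_link_or δ (by simp [(other_ne i).symm])] at h3
  have h4 : meanEntropy (fun v => (slotLaw δ).real {v}) (signal c a i) (fun v => v i i) n ≤
      meanEntropy (fun v => (slotLaw δ).real {v}) (signal c a i)
        (fun v => v i i || v i (other i)) n :=
    meanEntropy_mono (fun _ => measureReal_nonneg)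
      (fun v hv => by simp [show v i i = true from hv]) n
  have hq : 0 ≤ 1 - (δ i (other i) : ℝ) := sub_nonneg.2 (δ i (other i)).2.2
  have hp : 0 ≤ 1 - (δ i i : ℝ) * δ i (other i) :=
    sub_nonneg.2 (mul_le_one₀ (δ i i).2.2 (δ i (other i)).2.1 (δ i (other i)).2.2)
  -- These are the weights for which `h3` cancels the two entropies.
  have h5 := mul_le_mul_of_nonneg_left (h1.trans h4) hq
  have h6 := mul_le_mul_of_nonneg_left h2 hp
  refine le_of_mul_le_mul_right ?_ (Real.log_pos one_lt_two)
  generalize avgDecoded δ c a i = A at *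
  generalize avgDecoded δ c a (other i) = B at *
  linarith

end Mean

/-! ### Averaging over bits and arrivals -/

section Expectation

open Finset

variable {n : ℕ}

instance : IsProbabilityMeasure bitLaw := by
  unfold bitLaw; infer_instance

instance (l : Fin 2 → ℝ) (n : ℕ) : IsProbabilityMeasure (arrivalLaw l n) := by
  unfold arrivalLaw; infer_instance

instance (δ : Erasures) (l : Fin 2 → ℝ) (n : ℕ) : IsProbabilityMeasure (law δ l n) := by
  unfold law; infer_instance

/-- The bits that arrive during the `n` slots. -/
def arrivedBits (a : Fin 2 → Fin n → ℕ) (b : Fin 2 → ℕ → Bool) : ∀ j, Message a j :=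
  fun j k => b j k

lemma measurable_arrivedBits (a : Fin 2 → Fin n → ℕ) : Measurable (arrivedBits a) := by
  unfold arrivedBits
  fun_prop

/-- The event is a cylinder fixing finitely many fair bits. -/
lemma bitLaw_arrivedBits (a : Fin 2 → Fin n → ℕ) (ω : ∀ j, Message a j) :
    bitLaw (arrivedBits a ⁻¹' {ω}) = ((Fintype.card (∀ j, Message a j) : ℕ) : ENNReal)⁻¹ := by
  have h : arrivedBits a ⁻¹' {ω} = Set.univ.pi fun j =>
      ((range (∑ t, a j t) : Finset ℕ) : Set ℕ).pi fun k => {extend (ω j) k} := by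
    ext b
    simp only [Set.mem_preimage, Set.mem_singleton_iff, arrivedBits, funext_iff, Set.mem_pi,
      Set.mem_univ, true_imp_iff, coe_range, Set.mem_Iio]
    refine forall_congr' fun j => ⟨fun hb k hk => ?_, fun hb k => ?_⟩
    · simpa using (hb ⟨k, hk⟩).trans (extend_val (ω j) ⟨k, hk⟩).symm
    · simpa using hb k k.isLt
  have hb : ∀ y : Bool, (PMF.uniformOfFintype Bool).toMeasure {y} = 2⁻¹ := by
    intro y
    rw [PMF.toMeasure_apply_singleton _ _ (measurableSet_singleton y)]
    simp
  rw [h, bitLaw, Measure.pi_pi]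
  have h2 : ∀ j, (Measure.infinitePi fun _ : ℕ => (PMF.uniformOfFintype Bool).toMeasure)
      (((range (∑ t, a j t) : Finset ℕ) : Set ℕ).pi fun k => {extend (ω j) k}) =
      2⁻¹ ^ (∑ t, a j t) := by
    intro j
    rw [Measure.infinitePi_pi _ fun _ _ => measurableSet_singleton _]
    simp [hb]
  rw [prod_congr rfl fun j _ => h2 j, Fintype.card_pi]
  simp only [Fintype.card_pi, Fintype.card_bool, prod_const, card_univ, Fintype.card_fin,
    prod_pow_eq_pow_sum]
  rw [← ENNReal.inv_pow]
  push_cast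
  rfl

/-- The expectation of a function of the arrived bits is an average over messages. -/
lemma lintegral_arrivedBits (a : Fin 2 → Fin n → ℕ) (F : (∀ j, Message a j) → ℝ)
    (hF : ∀ ω, 0 ≤ F ω) :
    ∫⁻ b, ENNReal.ofReal (F (arrivedBits a b)) ∂bitLaw =
      ENNReal.ofReal ((∑ ω, F ω) / Fintype.card (∀ j, Message a j)) := by
  rw [← lintegral_map (f := fun ω => ENNReal.ofReal (F ω)) (measurable_of_finite _)
    (measurable_arrivedBits a), lintegral_fintype]
  have hpos : (0 : ℝ) < Fintype.card (∀ j, Message a j) := by exact_mod_cast Fintype.card_pos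
  rw [ENNReal.ofReal_div_of_pos hpos, ENNReal.ofReal_sum_of_nonneg fun ω _ => hF ω,
    ENNReal.div_eq_inv_mul, mul_comm, sum_mul]
  refine sum_congr rfl fun ω _ => ?_
  rw [Measure.map_apply (measurable_arrivedBits a) (measurableSet_singleton ω),
    bitLaw_arrivedBits, ENNReal.ofReal_natCast]

/-- States and arrivals range over countable types; once they are fixed, the count factors through
the finite set of messages. -/
lemma measurable_numDecodable (c : Scheme n) (i : Fin 2) :
    Measurable fun ω : Outcome n => numDecodable c ω.1 ω.2.1 ω.2.2 i := by
  refine measurable_from_prod_countable_right fun s => ?_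
  refine measurable_from_prod_countable_right fun a => ?_
  simp only [numDecodable_eq_decodedCount]
  exact (measurable_of_finite (decodedCount c s a i)).comp (measurable_arrivedBits a)

/-- The arrivals are integrated last: the bound holds for each pattern, so their law is irrelevant
beyond having mass one. The lower integral needs no prior integrability. -/
lemma lintegral_weighted_le (δ : Erasures) (l : Fin 2 → ℝ) (c : Scheme n) (α : Fin 2 → ℝ)
    (hα : ∀ i, 0 ≤ α i) (B : ℝ) (hB : ∀ a, ∑ i, α i * avgDecoded δ c a i ≤ B) :
    ∫⁻ ω, ENNReal.ofReal (∑ i, α i * numDecodable c ω.1 ω.2.1 ω.2.2 i) ∂law δ l n ≤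
      ENNReal.ofReal B := by
  have hmeas : Measurable fun ω : Outcome n =>
      ENNReal.ofReal (∑ i, α i * numDecodable c ω.1 ω.2.1 ω.2.2 i) := by
    refine ENNReal.measurable_ofReal.comp (Finset.measurable_fun_sum _ fun i _ => ?_)
    exact (measurable_from_nat.comp (measurable_numDecodable c i)).const_mul _
  have hs : ∀ s, ∫⁻ y, ENNReal.ofReal (∑ i, α i * numDecodable c s y.1 y.2 i)
      ∂(arrivalLaw l n).prod bitLaw = ∫⁻ a, ∫⁻ b,
        ENNReal.ofReal (∑ i, α i * numDecodable c s a b i) ∂bitLaw ∂arrivalLaw l n :=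
    fun s => lintegral_prod _ (hmeas.comp measurable_prodMk_left).aemeasurable
  rw [law, lintegral_prod _ hmeas.aemeasurable]
  simp only [hs]
  rw [lintegral_lintegral_swap (measurable_of_countable _).aemeasurable]
  have ha : ∀ a, ∫⁻ s, ∫⁻ b, ENNReal.ofReal (∑ i, α i * numDecodable c s a b i) ∂bitLaw
      ∂channelLaw δ n ≤ ENNReal.ofReal B := by
    intro a
    have h1 : ∀ s, ∫⁻ b, ENNReal.ofReal (∑ i, α i * numDecodable c s a b i) ∂bitLaw =
        ENNReal.ofReal (∑ i, α i * meanDecoded c s a i) := by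
      intro s
      simp only [numDecodable_eq_decodedCount]
      refine (lintegral_arrivedBits a (fun ω => ∑ i, α i * (decodedCount c s a i ω : ℝ))
        fun ω => sum_nonneg fun i _ => mul_nonneg (hα i) (by positivity)).trans ?_
      congr 1
      unfold meanDecoded
      rw [sum_comm, sum_div]
      refine sum_congr rfl fun i _ => ?_
      rw [← mul_sum, mul_div_assoc]
    simp only [h1]
    rw [lintegral_fintype]
    have h0 : ∀ s, 0 ≤ ∑ i, α i * meanDecoded c s a i := fun s =>
      sum_nonneg fun i _ => mul_nonneg (hα i) (by unfold meanDecoded; positivity)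
    have h2 : ∀ s, ENNReal.ofReal (∑ i, α i * meanDecoded c s a i) * channelLaw δ n {s} =
        ENNReal.ofReal ((∑ i, α i * meanDecoded c s a i) * (channelLaw δ n).real {s}) := by
      intro s
      rw [ENNReal.ofReal_mul (h0 s), ofReal_measureReal]
    rw [sum_congr rfl fun s _ => h2 s, ← ENNReal.ofReal_sum_of_nonneg
      fun s _ => mul_nonneg (h0 s) measureReal_nonneg]
    refine ENNReal.ofReal_le_ofReal (le_trans (le_of_eq ?_) (hB a))
    unfold avgDecoded
    simp only [mul_sum, sum_mul]
    rw [sum_comm]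
    exact sum_congr rfl fun i _ => sum_congr rfl fun s _ => by ring
  refine (lintegral_mono ha).trans ?_
  simp

/-- Finiteness of the mean comes from the single-user bound, not from Poisson moments. -/
lemma integrable_numDecodable (δ : Erasures) (l : Fin 2 → ℝ) (c : Scheme n) (i : Fin 2) :
    Integrable (fun ω => (numDecodable c ω.1 ω.2.1 ω.2.2 i : ℝ)) (law δ l n) := by
  have hm : Measurable fun ω : Outcome n => (numDecodable c ω.1 ω.2.1 ω.2.2 i : ℝ) :=
    measurable_from_nat.comp (measurable_numDecodable c i)
  refine ⟨hm.aestronglyMeasurable, ?_⟩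
  rw [hasFiniteIntegral_iff_ofReal (ae_of_all _ fun ω => by positivity)]
  have h := lintegral_weighted_le δ l c (Pi.single i 1)
    (fun j => (Pi.single_nonneg (α := fun _ : Fin 2 => ℝ)).2 zero_le_one j) (n * (1 - δ i i))
    (fun a => by simpa [Pi.single_apply] using avgDecoded_le δ c a i)
  refine lt_of_le_of_lt (le_trans (le_of_eq ?_) h) ENNReal.ofReal_lt_top
  simp [Pi.single_apply]

/-- A linear bound that holds for every arrival pattern holds for the delivered rates. -/
lemma sum_mul_deliveredRate_le (δ : Erasures) (l : Fin 2 → ℝ) (c : Scheme n) (α : Fin 2 → ℝ)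
    (hα : ∀ i, 0 ≤ α i) {B : ℝ} (hB0 : 0 ≤ B)
    (hB : ∀ a, ∑ i, α i * avgDecoded δ c a i ≤ n * B) :
    ∑ i, α i * deliveredRate δ l c i ≤ B := by
  have h := lintegral_weighted_le δ l c α hα _ hB
  have hint : ∑ i, α i * ∫ ω, (numDecodable c ω.1 ω.2.1 ω.2.2 i : ℝ) ∂law δ l n ≤ n * B := by
    simp only [← integral_const_mul]
    rw [← integral_finsetSum _ fun i _ => (integrable_numDecodable δ l c i).const_mul _,
      integral_eq_lintegral_of_nonneg_ae]
    · exact ENNReal.toReal_le_of_le_ofReal (by positivity) h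
    · exact ae_of_all _ fun ω => sum_nonneg fun i _ => mul_nonneg (hα i) (by positivity)
    · exact (integrable_finsetSum _ fun i _ =>
        (integrable_numDecodable δ l c i).const_mul _).aestronglyMeasurable
  simp only [deliveredRate, integral_div, ← mul_div_assoc]
  rw [← sum_div]
  -- This form covers `n = 0`, where the quotient is 0; hence the assumption `0 ≤ B`.
  exact div_le_of_le_mul₀ (by positivity) hB0 (by linarith)

end Expectation

/-! ### From delivered rates to the throughput regions -/

section Region

lemma deliveredRate_mem_outerBound (δ : Erasures) (l : Fin 2 → ℝ) {n : ℕ} (c : Scheme n) :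
    (fun i => deliveredRate δ l c i) ∈ outerBound δ := by
  have h0 : ∀ i j, 0 ≤ 1 - (δ i j : ℝ) := fun i j => sub_nonneg.2 (δ i j).2.2
  have h1 : ∀ i j k m, 0 ≤ 1 - (δ i j : ℝ) * δ k m := fun i j k m =>
    sub_nonneg.2 (mul_le_one₀ (δ i j).2.2 (δ k m).2.1 (δ k m).2.2)
  intro i
  refine ⟨⟨?_, ?_⟩, fun hlt => ?_⟩
  · exact integral_nonneg fun ω => by positivity
  · have := sum_mul_deliveredRate_le δ l c (Pi.single i 1)
      (fun j => (Pi.single_nonneg (α := fun _ : Fin 2 => ℝ)).2 zero_le_one j) (h0 i i)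
      (fun a => by simpa [Pi.single_apply] using avgDecoded_le δ c a i)
    simpa [Pi.single_apply] using this
  · have hsum : ∀ f : Fin 2 → ℝ, ∑ j, f j = f i + f (other i) := fun f => by
      fin_cases i <;> simp [add_comm]
    have := sum_mul_deliveredRate_le δ l c
      (fun j => if j = i then 1 - (δ i (other i) : ℝ) else 1 - (δ i i : ℝ) * δ i (other i))
      (fun j => by split_ifs; exacts [h0 _ _, h1 _ _ _ _]) (mul_nonneg (h1 _ _ _ _) (h1 _ _ _ _))
      (fun a => by
        rw [hsum]
        simpa only [if_true, if_neg (other_ne i)] using avgDecoded_add_le δ c a i)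
    rw [hsum] at this
    simp only [if_true, if_neg (other_ne i)] at this
    have hq : 0 < 1 - (δ i (other i) : ℝ) := sub_pos.2 hlt
    rw [le_div_iff₀ hq]
    refine le_trans (le_of_eq ?_) this
    field_simp

/-- All coefficients are nonnegative. Needed because stability bounds the delivered rates only from
below. -/
lemma mem_outerBound_of_le {δ : Erasures} {x y : Fin 2 → ℝ} (hy : y ∈ outerBound δ)
    (h0 : ∀ i, 0 ≤ x i) (hxy : ∀ i, x i ≤ y i) : x ∈ outerBound δ := by
  refine fun i => ⟨⟨h0 i, (hxy i).trans (hy i).1.2⟩, fun hlt => ?_⟩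
  refine le_trans (add_le_add (hxy i) (mul_le_mul_of_nonneg_left (hxy _) ?_)) ((hy i).2 hlt)
  exact div_nonneg (sub_nonneg.2 (mul_le_one₀ (δ i i).2.2 (δ i (other i)).2.1
    (δ i (other i)).2.2)) (sub_nonneg.2 hlt.le)

lemma isClosed_outerBound (δ : Erasures) : IsClosed (outerBound δ) := by
  simp only [outerBound, Set.ofPred_forall, Set.ofPred_and]
  refine isClosed_iInter fun i => ((isClosed_le ?_ ?_).inter (isClosed_le ?_ ?_)).inter
    (isClosed_iInter fun _ => isClosed_le ?_ ?_)
  all_goals fun_prop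

lemma IsStable.eventually_smul_mem {δ : Erasures} {ε : ℕ → ℝ} {l : Fin 2 → ℝ}
    (h : IsStable δ ε l) (hε : ∀ᶠ n in atTop, ε n ≤ 1) :
    ∀ᶠ n in atTop, (1 - ε n) • l ∈ outerBound δ := by
  obtain ⟨hl, c, hc⟩ := h
  filter_upwards [hc, hε] with n hn h1
  refine mem_outerBound_of_le (deliveredRate_mem_outerBound δ l (c n)) (fun i => ?_) fun i => ?_
  · exact mul_nonneg (sub_nonneg.2 h1) (hl i).1
  · simpa [mul_comm] using (hn i).le

lemma stableRegion_subset_outerBound (δ : Erasures) : stableRegion δ ⊆ outerBound δ := by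
  refine closure_minimal ?_ (isClosed_outerBound δ)
  rintro l ⟨ε, -, hlim, hst⟩
  -- The scaled pairs lie in the closed outer region eventually, and so does their limit.
  have ht : Tendsto (fun n => (1 - ε n) • l) atTop (𝓝 l) := by
    simpa using (hlim.const_sub 1).smul_const l
  exact (isClosed_outerBound δ).mem_of_tendsto ht
    (hst.eventually_smul_mem (hlim.eventually_le_const one_pos))

lemma smul_mem_outerBound_of_mem_epsStableRegion (δ : Erasures) {ε : ℝ} (hε : ε < 1)
    {l : Fin 2 → ℝ} (hl : l ∈ epsStableRegion δ ε) : (1 - ε) • l ∈ outerBound δ := by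
  have hcl : IsClosed ((fun x : Fin 2 → ℝ => (1 - ε) • x) ⁻¹' outerBound δ) :=
    (isClosed_outerBound δ).preimage (continuous_const_smul _)
  refine closure_minimal (fun x hx => ?_) hcl hl
  have hx : IsStable δ (fun _ => ε) x := hx
  exact (hx.eventually_smul_mem (Eventually.of_forall fun _ => hε.le)).exists.choose_spec

end Region

end IntermittentIC

theorem theorem2 (δ : Fin 2 → Fin 2 → unitInterval) :
    IntermittentIC.stableRegion δ ⊆ IntermittentIC.outerBound δ ∧
      ∀ ε : ℝ, 0 < ε → ε < 1 → ∀ l ∈ IntermittentIC.epsStableRegion δ ε,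
        (1 - ε) • l ∈ IntermittentIC.outerBound δ :=
  ⟨IntermittentIC.stableRegion_subset_outerBound δ, fun _ _ hε _ hl =>
    IntermittentIC.smul_mem_outerBound_of_mem_epsStableRegion δ hε hl⟩
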